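/- Let $k$ be a field and let $H$ be a Hopf algebra over $k$ (not necessarily finite dimensional) with comultiplication $\Delta(h)=h_1\otimes h_2$, counit $\varepsilon$ and antipode $S$. Regard $H^*$ as an algebra under convolution. Assume that $H$ is co-Frobenius: the maximal rational submodule $H^{*\mathrm{rat}}$ of the left $H^*$-module $H^*$ is nonzero, where $p\in H^{*\mathrm{rat}}$ means that there is $\sum_i p_i\otimes h_i\in H^*\otimes H$ with $f*p=\sum_i f(h_i)p_i$ for all $f\in H^*$. A left integral for $H$ is a functional $\lambda\in H^*$ with $f*\lambda=f(1)\lambda$ for all $f\in H^*$. Let $R=R^1\otimes R^2=r^1\otimes r^2\in H\otimes H$ be invertible and such that $(H,R)$ is quasitriangular, that is, $\Delta^{\mathrm{cop}}(h)=R\,\Delta(h)R^{-1}$ for all $h\in H$, $\Delta(R^1)\otimes R^2=R^1\otimes r^1\otimes R^2r^2$, $R^1\otimes\Delta(R^2)=R^1r^1\otimes r^2\otimes R^2$, $\varepsilon(R^1)R^2=1$ and $\varepsilon(R^2)R^1=1$. Put $u=S(R^2)R^1$. Then there are a unique grouplike element $a\in H$ (the modular element of $H$) with $\lambda(h_1)h_2=\lambda(h)a^{-1}$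 for all left integrals $\lambda$ and all $h\in H$, and a unique algebra automorphism $\chi$ of $H$ (the generalized Frobenius automorphism) with $\lambda(mh)=\lambda(\chi(h)m)$ for all left integrals $\lambda$ and all $h,m\in H$. Let $\alpha=\varepsilon\circ\chi$ (the modular element of $H$ in $H^*$) and $a_\alpha=\alpha(R^1)R^2$. Moreover $S(u)$ is invertible; let $v=S(u)^{-1}$. The following hold. (i) If $\alpha=\varepsilon$, then $S(u)^{-1}u=vu=a$; consequently $S(u)^{-1}u$ does not depend on $R$: if $(H,R')$ is quasitriangular too and $u'$ is the element $u$ formed from $R'$, then $S(u')^{-1}u'=S(u)^{-1}u$. (ii) $S(u)=u$ if and only if $a_\alpha=a^{-1}$. -/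

import Mathlib

open scoped TensorProduct

namespace CoFrobeniusHopf

noncomputable section

/-! Integrals, rational functionals and modular elements of a Hopf algebra.
The dual of `H` is an algebra under the convolution product, which Mathlib writes as the
multiplication of `WithConv (H →ₗ[k] k)`. -/

section Integrals

variable (k : Type*) (H : Type*) [Field k] [Ring H] [HopfAlgebra k H]

/-- For `t = ∑ pᵢ ⊗ hᵢ` in `H* ⊗ H` and `f` in `H*`, the functional `∑ f(hᵢ) pᵢ`. -/
def dualAct (f : Module.Dual k H) : (Module.Dual k H) ⊗[k] H →ₗ[k] Module.Dual k H :=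
  (TensorProduct.rid k (Module.Dual k H)).toLinearMap ∘ₗ f.lTensor (Module.Dual k H)

/-- The maximal rational submodule of the left `H*`-module `H*`: all `p` for which there is
`∑ pᵢ ⊗ hᵢ` in `H* ⊗ H` with `f * p = ∑ f(hᵢ) pᵢ` for every `f` in `H*`. -/
def rationalDual : Submodule k (Module.Dual k H) where
  carrier := {p | ∃ t : (Module.Dual k H) ⊗[k] H, ∀ f : Module.Dual k H,
    WithConv.toConv f * WithConv.toConv p = WithConv.toConv (dualAct k H f t)}
  zero_mem' := ⟨0, fun f => by simp⟩
  add_mem' := by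
    rintro p q ⟨s, hs⟩ ⟨t, ht⟩
    exact ⟨s + t, fun f => by
      rw [WithConv.toConv_add, mul_add, hs, ht, map_add, WithConv.toConv_add]⟩
  smul_mem' := by
    rintro c p ⟨t, ht⟩
    exact ⟨c • t, fun f => by
      rw [WithConv.toConv_smul, mul_smul_comm, ht, map_smul, WithConv.toConv_smul]⟩

/-- `H` is co-Frobenius: the rational part of `H*` is nonzero. -/
def IsCoFrobenius : Prop := rationalDual k H ≠ ⊥

variable {k H}

/-- `l` is a left integral for `H` in `H*`: `f * l = f(1) l` for all `f` in `H*`. -/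
def IsLeftIntegral (l : Module.Dual k H) : Prop :=
  ∀ f : Module.Dual k H,
    WithConv.toConv f * WithConv.toConv l = f 1 • WithConv.toConv l

/-- `a` is the modular (distinguished group-like) element of `H`:
`l(h₁) h₂ = l(h) a⁻¹` for all left integrals `l` and all `h`. -/
def IsModularElement (a : GroupLike k H) : Prop :=
  ∀ l : Module.Dual k H, IsLeftIntegral l → ∀ h : H,
    TensorProduct.lid k H (l.rTensor H (Coalgebra.comul (R := k) h)) = l h • (a⁻¹).val

/-- `χ` is the generalized Frobenius automorphism of `H`: for every left integral `l`,
`h ⇀ l = l ↼ χ(h)`, that is, `l(mh) = l(χ(h)m)` for all `h` and `m`. -/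
def IsFrobeniusAut (χ : H ≃ₐ[k] H) : Prop :=
  ∀ l : Module.Dual k H, IsLeftIntegral l → ∀ h m : H, l (m * h) = l (χ h * m)

/-- The functional `ε ∘ χ`; it is the modular element of `H` in `H*` when `χ` is the
generalized Frobenius automorphism. -/
def modularFunctional (χ : H ≃ₐ[k] H) : H →ₐ[k] k :=
  (Bialgebra.counitAlgHom k H).comp χ.toAlgHom

end Integrals

section Quasitriangular

variable {k : Type*} {H : Type*} [Field k] [Ring H] [HopfAlgebra k H]

/-- `R = R¹ ⊗ R²` placed in the first two factors: `R¹ ⊗ R² ⊗ 1`. -/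
def leg12 : H ⊗[k] H →ₐ[k] H ⊗[k] (H ⊗[k] H) :=
  Algebra.TensorProduct.map (AlgHom.id k H) Algebra.TensorProduct.includeLeft

/-- `R = R¹ ⊗ R²` placed in the outer factors: `R¹ ⊗ 1 ⊗ R²`. -/
def leg13 : H ⊗[k] H →ₐ[k] H ⊗[k] (H ⊗[k] H) :=
  Algebra.TensorProduct.map (AlgHom.id k H) Algebra.TensorProduct.includeRight

/-- `R = R¹ ⊗ R²` placed in the last two factors: `1 ⊗ R¹ ⊗ R²`. -/
def leg23 : H ⊗[k] H →ₐ[k] H ⊗[k] (H ⊗[k] H) :=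
  Algebra.TensorProduct.includeRight

/-- `(H, R)` is a quasitriangular Hopf algebra. -/
structure IsQuasitriangular (R : (H ⊗[k] H)ˣ) : Prop where
  /-- `Δᶜᵒᵖ(h) = R Δ(h) R⁻¹` -/
  comul_cop : ∀ h : H, TensorProduct.comm k H H (Coalgebra.comul h) =
    (R : H ⊗[k] H) * Coalgebra.comul h * ((R⁻¹ : (H ⊗[k] H)ˣ) : H ⊗[k] H)
  /-- `Δ(R¹) ⊗ R² = R¹ ⊗ r¹ ⊗ R² r²` -/
  comul_left : TensorProduct.assoc k H H H
      ((Coalgebra.comul (R := k) (A := H)).rTensor H (R : H ⊗[k] H)) =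
    leg13 (R : H ⊗[k] H) * leg23 (R : H ⊗[k] H)
  /-- `R¹ ⊗ Δ(R²) = R¹ r¹ ⊗ r² ⊗ R²` -/
  comul_right : (Coalgebra.comul (R := k) (A := H)).lTensor H (R : H ⊗[k] H) =
    leg13 (R : H ⊗[k] H) * leg12 (R : H ⊗[k] H)
  /-- `ε(R¹) R² = 1` -/
  counit_left : TensorProduct.lid k H
    ((Coalgebra.counit (R := k) (A := H)).rTensor H (R : H ⊗[k] H)) = 1
  /-- `ε(R²) R¹ = 1` -/
  counit_right : TensorProduct.rid k H
    ((Coalgebra.counit (R := k) (A := H)).lTensor H (R : H ⊗[k] H)) = 1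

/-- `u = S(R²) R¹`. -/
def elemU (R : (H ⊗[k] H)ˣ) : H :=
  LinearMap.mul' k H ((HopfAlgebra.antipode k (A := H)).rTensor H
    (TensorProduct.comm k H H (R : H ⊗[k] H)))

/-- `v = S(u)⁻¹` (meaningful when `S(u)` is invertible). -/
def elemV (R : (H ⊗[k] H)ˣ) : H :=
  Ring.inverse (HopfAlgebra.antipode k (elemU R))

/-- `a_η = η(R¹) R²` for an algebra map `η : H → k`. -/
def evalLeft (η : H →ₐ[k] k) (R : (H ⊗[k] H)ˣ) : H :=
  TensorProduct.lid k H (η.toLinearMap.rTensor H (R : H ⊗[k] H))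

end Quasitriangular

end

end CoFrobeniusHopf

/-! Everything follows from one identity, `elemU_mul_modularElement_inv`: u a⁻¹ = S(u) a_α. Since u
and a are invertible, cancelling u gives one direction of (ii) and cancelling a⁻¹ the other. If α =
ε, then a_α = 1, so S(u)⁻¹u = a, which does not involve R.

To obtain it, fix a nonzero left integral λ and apply λ ⊗ id to R Δ(h) = Δᶜᵒᵖ(h) R. The translation
rules for integrals, the formula for Δ(R¹) ⊗ R² and (S ⊗ S)R = R turn this into λ(R¹h)R² u a⁻¹ =
S(u) λ(hR¹)R² (`evalFst_mul_tmul_one_mul`). Now λ(hR¹) = λ(χ(R¹)h), and y ↦ λ(y ·) is injective, so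
R¹ ⊗ R²ua⁻¹ = χ(R¹) ⊗ S(u)R²; applying ε to the first factor gives the identity.

The rest builds the theory of integrals without finiteness. The Hopf module projection of H*ʳᵃᵗ onto
its coinvariants gives a left integral λ with λ ∘ S ≠ 0, and λ ∘ S is a right integral. Comparing
translates of left and right integrals (`apply_exchange`) gives bijectivity of S, uniqueness of λ up
to scalars and the existence of χ. A recurring device, `sum_evalFst_eq_of_forall`, substitutes for v
in an identity ∑ fᵢ(v) yᵢ = ∑ gⱼ(v) zⱼ something that depends on yᵢ and zⱼ themselves. -/

open scoped TensorProduct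

namespace CoFrobeniusHopf

noncomputable section

open Coalgebra HopfAlgebra TensorProduct WithConv

/-! ### Slices of tensors and substitution into functionals -/

section Evaluation

variable {k V W U U' : Type*} [Field k] [AddCommGroup V] [Module k V] [AddCommGroup W] [Module k W]
  [AddCommGroup U] [Module k U] [AddCommGroup U'] [Module k U']

/-- Evaluation of a functional on the first tensor factor. -/
def evalFst (f : Module.Dual k V) : V ⊗[k] W →ₗ[k] W :=
  (TensorProduct.lid k W).toLinearMap ∘ₗ f.rTensor W

/-- Evaluation of a functional on the second tensor factor. -/
def evalSnd (f : Module.Dual k W) : V ⊗[k] W →ₗ[k] V :=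
  (TensorProduct.rid k V).toLinearMap ∘ₗ f.lTensor V

@[simp] lemma evalFst_tmul (f : Module.Dual k V) (v : V) (w : W) :
    evalFst f (v ⊗ₜ[k] w) = f v • w := by simp [evalFst]

@[simp] lemma evalSnd_tmul (f : Module.Dual k W) (v : V) (w : W) :
    evalSnd f (v ⊗ₜ[k] w) = f w • v := by simp [evalSnd]

lemma dual_ext {v w : V} (h : ∀ f : Module.Dual k V, f v = f w) : v = w := by
  rw [← sub_eq_zero, ← Module.forall_dual_apply_eq_zero_iff k]
  intro f
  simp [h f]

/-- An element of `Hom(V, W) ⊗ U` is determined by its evaluations at the vectors of `V`. -/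
lemma hom_tensor_ext {z z' : (V →ₗ[k] W) ⊗[k] U}
    (h : ∀ v, (LinearMap.applyₗ (R := k) v).rTensor U z =
      (LinearMap.applyₗ (R := k) v).rTensor U z') : z = z' := by
  classical
  let b := Module.Basis.ofVectorSpace k U
  apply (TensorProduct.equivFinsuppOfBasisRight (M := V →ₗ[k] W) b).injective
  ext i v
  have key : ∀ y : (V →ₗ[k] W) ⊗[k] U,
      (TensorProduct.equivFinsuppOfBasisRight b y i) v =
        TensorProduct.equivFinsuppOfBasisRight b
          ((LinearMap.applyₗ (R := k) v).rTensor U y) i := by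
    intro y
    induction y with
    | zero => simp
    | tmul a c => simp
    | add x y hx hy => simp [hx, hy]
  rw [key, key, h]

/-- The map `Hom(V, W) ⊗ U → W ⊗ U'` sending `g ⊗ y` to `(g ⊗ id)(T y)`. -/
def substHom (T : U →ₗ[k] V ⊗[k] U') : (V →ₗ[k] W) ⊗[k] U →ₗ[k] W ⊗[k] U' :=
  TensorProduct.lift ((LinearMap.lcomp k _ T) ∘ₗ LinearMap.rTensorHom U')

@[simp] lemma substHom_tmul (T : U →ₗ[k] V ⊗[k] U') (g : V →ₗ[k] W) (y : U) :
    substHom T (g ⊗ₜ[k] y) = g.rTensor U' (T y) := by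
  simp [substHom]

/-- If `∑ fᵢ(v) yᵢ = ∑ gⱼ(v) zⱼ` for all `v`, then `∑ (fᵢ ⊗ id)(T yᵢ) = ∑ (gⱼ ⊗ id)(T zⱼ)`. -/
lemma sum_evalFst_eq_of_forall {ι κ : Type*} {s : Finset ι} {s' : Finset κ}
    {f : ι → Module.Dual k V} {y : ι → U} {g : κ → Module.Dual k V} {z : κ → U}
    (h : ∀ v, ∑ i ∈ s, f i v • y i = ∑ j ∈ s', g j v • z j) (T : U →ₗ[k] V ⊗[k] U') :
    ∑ i ∈ s, evalFst (f i) (T (y i)) = ∑ j ∈ s', evalFst (g j) (T (z j)) := by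
  have key : ∑ i ∈ s, (f i) ⊗ₜ[k] (y i) = ∑ j ∈ s', (g j) ⊗ₜ[k] (z j) := by
    apply hom_tensor_ext
    intro v
    apply (TensorProduct.lid k U).injective
    simpa using h v
  simpa [evalFst] using congrArg (fun z => TensorProduct.lid k U' (substHom T z)) key

end Evaluation

/-! ### Antipode identities in the convolution algebra Hom(H, H ⊗ H) -/

section Convolution

variable {k H : Type*} [Field k] [Ring H] [HopfAlgebra k H] {ι : Type*}

local notation "S" => antipode k (A := H)

local notation "inl" =>
  AlgHom.toLinearMap (Algebra.TensorProduct.includeLeft : H →ₐ[k] H ⊗[k] H)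

local notation "inr" =>
  AlgHom.toLinearMap (Algebra.TensorProduct.includeRight : H →ₐ[k] H ⊗[k] H)

/-- With Δ factored into two convolution-invertible maps, the Sweedler identities below become
cancellations. -/
lemma toConv_comul : toConv (comul (R := k) (A := H)) = toConv inl * toConv inr := by
  ext h
  simp [(ℛ k h).convMul_apply, (ℛ k h).eq]

lemma algHom_antipode_mul {A : Type*} [Ring A] [Algebra k A] (f : H →ₐ[k] A) :
    toConv (f.toLinearMap ∘ₗ S) * toConv f.toLinearMap = 1 := by
  have := LinearMap.algHom_comp_convMul_distrib f (toConv S) (toConv LinearMap.id)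
  rw [LinearMap.antipode_mul_id] at this
  apply ofConv_injective
  simp only [LinearMap.comp_id] at this
  rw [← this]
  ext; simp

lemma algHom_mul_antipode {A : Type*} [Ring A] [Algebra k A] (f : H →ₐ[k] A) :
    toConv f.toLinearMap * toConv (f.toLinearMap ∘ₗ S) = 1 := by
  have := LinearMap.algHom_comp_convMul_distrib f (toConv LinearMap.id) (toConv S)
  rw [LinearMap.id_mul_antipode] at this
  apply ofConv_injective
  simp only [LinearMap.comp_id] at this
  rw [← this]
  ext; simp

lemma toConv_comul_antipode :
    toConv (comul (R := k) (A := H) ∘ₗ S) = toConv (inr ∘ₗ S) * toConv (inl ∘ₗ S) := by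
  symm
  refine left_inv_eq_right_inv (a := toConv (comul (R := k) (A := H))) ?_
    LinearMap.comul_right_inv
  rw [toConv_comul, mul_assoc, ← mul_assoc (toConv (inl ∘ₗ S)), algHom_antipode_mul, one_mul,
    algHom_antipode_mul]

lemma comul_antipode_repr {h : H} (r : Repr k h ι) :
    comul (R := k) (S h) = ∑ i ∈ r.index, S (r.right i) ⊗ₜ[k] S (r.left i) := by
  have := congrArg (fun F => F.ofConv h) (toConv_comul_antipode (k := k) (H := H))
  rw [r.convMul_apply] at this
  simpa using this

/-- The antipode reverses a presentation of the comultiplication. -/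
@[simps] def reprAntipode {h : H} (r : Repr k h ι) : Repr k (S h) ι where
  index := r.index
  left i := S (r.right i)
  right i := S (r.left i)
  eq := (comul_antipode_repr r).symm

lemma sum_antipode_tmul_mul_comul {h : H} (r : Repr k h ι) :
    ∑ i ∈ r.index, (S (r.left i) ⊗ₜ[k] (1 : H)) * comul (r.right i) = 1 ⊗ₜ[k] h := by
  have : toConv (inl ∘ₗ S) * toConv (comul (R := k) (A := H)) = toConv inr := by
    rw [toConv_comul, ← mul_assoc, algHom_antipode_mul, one_mul]
  have := congrArg (fun F => F.ofConv h) this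
  rw [r.convMul_apply] at this
  simpa using this

lemma sum_comul_mul_tmul_antipode {h : H} (r : Repr k h ι) :
    ∑ i ∈ r.index, comul (r.left i) * ((1 : H) ⊗ₜ[k] S (r.right i)) = h ⊗ₜ[k] 1 := by
  have : toConv (comul (R := k) (A := H)) * toConv (inr ∘ₗ S) = toConv inl := by
    rw [toConv_comul, mul_assoc, algHom_mul_antipode, mul_one]
  have := congrArg (fun F => F.ofConv h) this
  rw [r.convMul_apply] at this
  simpa using this

lemma sum_comul_antipode_mul_tmul {h : H} (r : Repr k h ι) :
    ∑ i ∈ r.index, comul (S (r.left i)) * (r.right i ⊗ₜ[k] (1 : H)) = 1 ⊗ₜ[k] S h := by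
  have : toConv (comul (R := k) (A := H) ∘ₗ S) * toConv inl = toConv (inr ∘ₗ S) := by
    rw [toConv_comul_antipode, mul_assoc, algHom_antipode_mul, mul_one]
  have := congrArg (fun F => F.ofConv h) this
  rw [r.convMul_apply] at this
  simpa using this

lemma sum_tmul_mul_antipode_comul {h : H} (r : Repr k h ι) :
    ∑ i ∈ r.index, (r.left i ⊗ₜ[k] (1 : H)) * (S).rTensor H (comul (r.right i)) =
      1 ⊗ₜ[k] h := by
  have e : toConv ((S).rTensor H ∘ₗ comul (R := k) (A := H)) =
      toConv (inl ∘ₗ S) * toConv inr := by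
    ext x
    simp [(ℛ k x).convMul_apply, ← (ℛ k x).eq]
  have : toConv inl * toConv ((S).rTensor H ∘ₗ comul (R := k) (A := H)) = toConv inr := by
    rw [e, ← mul_assoc, algHom_mul_antipode, one_mul]
  have := congrArg (fun F => F.ofConv h) this
  rw [r.convMul_apply] at this
  simpa using this

end Convolution

/-! ### Translates of integrals and bijectivity of the antipode -/

section Hopf

variable {k H : Type*} [Field k] [Ring H] [HopfAlgebra k H]

local notation "S" => antipode k (A := H)

@[simp] lemma evalSnd_tmul_one_mul (f : Module.Dual k H) (c : H) (w : H ⊗[k] H) :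
    evalSnd f ((c ⊗ₜ[k] (1 : H)) * w) = c * evalSnd f w := by
  induction w with
  | zero => simp
  | tmul a b => simp
  | add a b ha hb => simp [mul_add, ha, hb]

@[simp] lemma evalSnd_mul_tmul_one (f : Module.Dual k H) (c : H) (w : H ⊗[k] H) :
    evalSnd f (w * (c ⊗ₜ[k] (1 : H))) = evalSnd f w * c := by
  induction w with
  | zero => simp
  | tmul a b => simp
  | add a b ha hb => simp [add_mul, ha, hb]

@[simp] lemma evalFst_one_tmul_mul (f : Module.Dual k H) (c : H) (w : H ⊗[k] H) :
    evalFst f (((1 : H) ⊗ₜ[k] c) * w) = c * evalFst f w := by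
  induction w with
  | zero => simp
  | tmul a b => simp
  | add a b ha hb => simp [mul_add, ha, hb]

@[simp] lemma evalFst_mul_one_tmul (f : Module.Dual k H) (c : H) (w : H ⊗[k] H) :
    evalFst f (w * ((1 : H) ⊗ₜ[k] c)) = evalFst f w * c := by
  induction w with
  | zero => simp
  | tmul a b => simp
  | add a b ha hb => simp [add_mul, ha, hb]

lemma apply_evalSnd (f g : Module.Dual k H) (w : H ⊗[k] H) :
    g (evalSnd f w) = f (evalFst g w) := by
  induction w with
  | zero => simp
  | tmul a b => simp [mul_comm]
  | add a b ha hb => simp [ha, hb]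

lemma conv_apply_eq_evalSnd (f g : Module.Dual k H) (h : H) :
    (toConv f * toConv g) h = f (evalSnd g (comul h)) := by
  rw [(ℛ k h).convMul_apply, ← (ℛ k h).eq]
  simp [mul_comm]

lemma isLeftIntegral_iff {l : Module.Dual k H} :
    IsLeftIntegral l ↔ ∀ h, evalSnd l (comul h) = l h • (1 : H) := by
  constructor
  · intro hl h
    apply dual_ext (k := k)
    intro f
    rw [← conv_apply_eq_evalSnd, hl f]
    simp [mul_comm]
  · intro hl f
    ext h
    rw [conv_apply_eq_evalSnd, hl]
    simp [mul_comm]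

/-- `l` is a right integral for `H` in `H*`: `l(h₁) h₂ = l(h) 1` for all `h`. -/
def IsRightIntegral (l : Module.Dual k H) : Prop :=
  ∀ h, evalFst l (comul h) = l h • (1 : H)

/-- Expand 1 ⊗ m = ∑ (S(m₁) ⊗ 1)Δ(m₂) and use Δ(m₂)Δ(h) = Δ(m₂h). In Sweedler form, h₁ l(m h₂) =
S(m₁) l(m₂ h). -/
lemma IsLeftIntegral.evalSnd_one_tmul_mul_comul {l : Module.Dual k H} (hl : IsLeftIntegral l)
    (m h : H) :
    evalSnd l (((1 : H) ⊗ₜ[k] m) * comul h) = S (evalSnd l (comul m * ((1 : H) ⊗ₜ[k] h))) := by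
  rw [isLeftIntegral_iff] at hl
  rw [← sum_antipode_tmul_mul_comul (ℛ k m)]
  conv_rhs => rw [← (ℛ k m).eq]
  simp only [Finset.sum_mul, mul_assoc, map_sum, evalSnd_tmul_one_mul, ← Bialgebra.comul_mul, hl]
  simp

lemma IsLeftIntegral.evalSnd_comul_mul_antipode {l : Module.Dual k H} (hl : IsLeftIntegral l)
    {ι : Type*} (x : H) {h : H} (r : Repr k h ι) :
    evalSnd l (comul x * ((1 : H) ⊗ₜ[k] S h)) =
      ∑ i ∈ r.index, l (x * S (r.left i)) • r.right i := by
  rw [isLeftIntegral_iff] at hl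
  rw [← sum_comul_antipode_mul_tmul r]
  simp only [Finset.mul_sum, ← mul_assoc, map_sum, evalSnd_mul_tmul_one, ← Bialgebra.comul_mul, hl]
  simp

/-- The mirror rule, from m ⊗ 1 = ∑ Δ(m₁)(1 ⊗ S(m₂)). The element b covers both right integrals (b =
1) and left integrals (b = a⁻¹). -/
lemma evalFst_comul_mul_tmul_one {l : Module.Dual k H} {b : H}
    (hl : ∀ h, evalFst l (comul h) = l h • b) (h m : H) :
    evalFst l (comul h * (m ⊗ₜ[k] (1 : H))) =
      b * S (evalFst l ((h ⊗ₜ[k] (1 : H)) * comul m)) := by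
  rw [← sum_comul_mul_tmul_antipode (ℛ k m)]
  conv_rhs => rw [← (ℛ k m).eq]
  simp only [Finset.mul_sum, ← mul_assoc, map_sum, evalFst_mul_one_tmul, ← Bialgebra.comul_mul, hl]
  simp

lemma IsLeftIntegral.eq_zero_of_forall {l : Module.Dual k H} (hl : IsLeftIntegral l) (h0 : l ≠ 0)
    {h : H} (hh : ∀ x, l (x * S h) = 0) : h = 0 := by
  obtain ⟨x, hx⟩ : ∃ x, l x ≠ 0 := by
    by_contra! hc
    exact h0 (LinearMap.ext hc)
  let r := ℛ k h
  have e (y : H) : ∑ i ∈ r.index, l (y * S (r.left i)) • r.right i = 0 := by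
    rw [← hl.evalSnd_comul_mul_antipode, ← (ℛ k y).eq]
    simp only [Finset.sum_mul, map_sum, Algebra.TensorProduct.tmul_mul_tmul, evalSnd_tmul, hh,
      zero_smul, Finset.sum_const_zero]
  -- In ∑ l(y S(h₁)) h₂ = 0 put y = x S²(h₂), the old h₂ becoming h₃: the sum collapses to l(x) h.
  have key := sum_evalFst_eq_of_forall (s := r.index) (s' := (∅ : Finset ℕ))
    (f := fun i => l ∘ₗ LinearMap.mulRight k (S (r.left i))) (y := r.right) (g := 0) (z := 0)
    (by simpa using e)
    ((LinearMap.mulLeft k x ∘ₗ S ∘ₗ S).rTensor H ∘ₗ comul)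
  have id1 (c : H) (w : H ⊗[k] H) :
      evalFst (l ∘ₗ LinearMap.mulRight k (S c))
        ((LinearMap.mulLeft k x ∘ₗ S ∘ₗ S).rTensor H w) =
      evalFst (l ∘ₗ LinearMap.mulLeft k x ∘ₗ S)
        ((c ⊗ₜ[k] (1 : H)) * (S).rTensor H w) := by
    induction w with
    | zero => simp
    | tmul a b => simp [mul_assoc, antipode_mul_antidistrib]
    | add a b ha hb => simp [mul_add, ha, hb]
  simp only [LinearMap.comp_apply, id1, ← map_sum, sum_tmul_mul_antipode_comul] at key
  simpa [hx] using key

lemma IsLeftIntegral.antipode_injective {l : Module.Dual k H} (hl : IsLeftIntegral l)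
    (h0 : l ≠ 0) : Function.Injective S := by
  rw [injective_iff_map_eq_zero]
  intro h hh
  exact hl.eq_zero_of_forall h0 (by simp [hh])

lemma IsLeftIntegral.isRightIntegral_comp_antipode {l : Module.Dual k H} (hl : IsLeftIntegral l)
    (h0 : l ≠ 0) : IsRightIntegral (l ∘ₗ S) := by
  intro h
  apply hl.antipode_injective h0
  have := isLeftIntegral_iff.1 hl (S h)
  rw [comul_antipode_repr (ℛ k h)] at this
  rw [← (ℛ k h).eq]
  simpa using this

/-- The bilinear exchange between left and right translates of a left and a right integral. -/
lemma IsLeftIntegral.apply_exchange {l ρ : Module.Dual k H} (hl : IsLeftIntegral l)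
    (hρ : IsRightIntegral ρ) (n m h : H) :
    ρ (h * evalSnd (l ∘ₗ LinearMap.mulLeft k m ∘ₗ S) (comul n)) =
      l (evalFst (ρ ∘ₗ LinearMap.mulRight k n ∘ₗ S) (comul m) * h) := by
  have h1 := evalFst_comul_mul_tmul_one (b := 1) hρ h n
  have h2 := hl.evalSnd_one_tmul_mul_comul m h
  -- Both sides are ρ(h₁n) l(mh₂), sliced in the two possible orders.
  have h3 : l (m * evalFst ρ (comul h * (n ⊗ₜ[k] (1 : H)))) =
      ρ (evalSnd l (((1 : H) ⊗ₜ[k] m) * comul h) * n) := by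
    rw [← evalFst_one_tmul_mul, ← evalSnd_mul_tmul_one, apply_evalSnd, mul_assoc]
  rw [h1, h2, one_mul] at h3
  have h4 (w : H ⊗[k] H) : ρ (h * evalSnd (l ∘ₗ LinearMap.mulLeft k m ∘ₗ S) w) =
      l (m * S (evalFst ρ ((h ⊗ₜ[k] (1 : H)) * w))) := by
    induction w with
    | zero => simp
    | tmul a b => simp [mul_comm]
    | add a b ha hb => simp [mul_add, ha, hb]
  have h5 (w : H ⊗[k] H) : l (evalFst (ρ ∘ₗ LinearMap.mulRight k n ∘ₗ S) w * h) =
      ρ (S (evalSnd l (w * ((1 : H) ⊗ₜ[k] h))) * n) := by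
    induction w with
    | zero => simp
    | tmul a b => simp [mul_comm]
    | add a b ha hb => simp [add_mul, ha, hb]
  rw [h4, h5, h3]

lemma exists_apply_eq_one {l : Module.Dual k H} (h0 : l ≠ 0) : ∃ z, l z = 1 := by
  obtain ⟨x, hx⟩ : ∃ x, l x ≠ 0 := by
    by_contra! hc
    exact h0 (LinearMap.ext hc)
  exact ⟨(l x)⁻¹ • x, by simp [hx]⟩

lemma IsLeftIntegral.exists_left {l ρ : Module.Dual k H} (hl : IsLeftIntegral l)
    (hρ : IsRightIntegral ρ) (h0 : l ≠ 0) (x : H) : ∃ y, ∀ h, ρ (h * x) = l (y * h) := by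
  obtain ⟨z, hz⟩ := exists_apply_eq_one h0
  let r := ℛ k x
  -- Exchange with n = x₁ and m = z S²(x₂): the element on the ρ side is x₁ l(z S(x₂ S(x₃))) = l(z)
  -- x = x.
  refine ⟨∑ i ∈ r.index, evalFst (ρ ∘ₗ LinearMap.mulRight k (r.left i) ∘ₗ S)
    (comul (z * S (S (r.right i)))), fun h => ?_⟩
  simp only [Finset.sum_mul, map_sum, ← hl.apply_exchange hρ]
  rw [← map_sum, ← Finset.mul_sum]
  congr 2
  have id1 (c : H) (w : H ⊗[k] H) :
      evalSnd (l ∘ₗ LinearMap.mulLeft k (z * S (S c)) ∘ₗ S) w =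
        evalSnd (l ∘ₗ LinearMap.mulLeft k z ∘ₗ S) (w * ((1 : H) ⊗ₜ[k] S c)) := by
    induction w with
    | zero => simp
    | tmul a b => simp [antipode_mul_antidistrib]
    | add a b ha hb => rw [map_add, ha, hb, add_mul, map_add]
  simp only [id1, ← map_sum, sum_comul_mul_tmul_antipode]
  simp [hz]

lemma IsLeftIntegral.exists_right {l ρ : Module.Dual k H} (hl : IsLeftIntegral l)
    (hρ : IsRightIntegral ρ) (h0 : ρ ≠ 0) (y : H) : ∃ x, ∀ h, ρ (h * x) = l (y * h) := by
  obtain ⟨z, hz⟩ := exists_apply_eq_one h0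
  let r := ℛ k y
  -- Exchange with m = y₂ and n = S²(y₁) z: the element on the l side is ρ(S(S(y₁) y₂) z) y₃ = y.
  refine ⟨∑ i ∈ r.index, evalSnd (l ∘ₗ LinearMap.mulLeft k (r.right i) ∘ₗ S)
    (comul (S (S (r.left i)) * z)), fun h => ?_⟩
  simp only [Finset.mul_sum, map_sum, hl.apply_exchange hρ]
  rw [← map_sum, ← Finset.sum_mul]
  congr 2
  have id1 (c : H) (w : H ⊗[k] H) :
      evalFst (ρ ∘ₗ LinearMap.mulRight k (S (S c) * z) ∘ₗ S) w =
        evalFst (ρ ∘ₗ LinearMap.mulRight k z ∘ₗ S) ((S c ⊗ₜ[k] (1 : H)) * w) := by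
    induction w with
    | zero => simp
    | tmul a b => simp [antipode_mul_antidistrib, mul_assoc]
    | add a b ha hb => rw [map_add, ha, hb, mul_add, map_add]
  simp only [id1, ← map_sum, sum_antipode_tmul_mul_comul]
  simp [hz]

lemma IsLeftIntegral.antipode_surjective {l ρ : Module.Dual k H} (hl : IsLeftIntegral l)
    (hρ : IsRightIntegral ρ) (h0 : l ≠ 0) (h0' : ρ ≠ 0) : Function.Surjective S := by
  obtain ⟨w, hw⟩ := exists_apply_eq_one h0'
  intro g
  rw [← LinearMap.mem_range]
  have key (h x : H) : evalSnd ρ (comul h * ((1 : H) ⊗ₜ[k] x)) ∈ LinearMap.range S := by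
    obtain ⟨y, hy⟩ := hl.exists_left hρ h0 x
    have id1 (v : H ⊗[k] H) : evalSnd ρ (v * ((1 : H) ⊗ₜ[k] x)) =
        evalSnd l (((1 : H) ⊗ₜ[k] y) * v) := by
      induction v with
      | zero => simp
      | tmul a b => simp [hy]
      | add a b ha hb => simp [mul_add, add_mul, ha, hb]
    rw [id1, hl.evalSnd_one_tmul_mul_comul]
    exact LinearMap.mem_range_self _ _
  -- g = g₁ ρ(g₂ S(g₃) w), a sum of elements h₁ ρ(h₂ x), each of which lies in the range of S.
  have e : ∑ i ∈ (ℛ k g).index, evalSnd ρ (comul ((ℛ k g).left i) *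
      ((1 : H) ⊗ₜ[k] (S ((ℛ k g).right i) * w))) = g := by
    have (c : H) : (1 : H) ⊗ₜ[k] (c * w) = (1 : H) ⊗ₜ[k] c * (1 : H) ⊗ₜ[k] w := by simp
    simp only [this, ← mul_assoc, ← map_sum, ← Finset.sum_mul, sum_comul_mul_tmul_antipode]
    simp [hw]
  rw [← e]
  exact Submodule.sum_mem _ fun i _ => key _ _

/-! ### Rational functionals and existence of integrals -/

/-- The family `∑ qᵢ ⊗ yᵢ` in `H* ⊗ H` is the value of the coaction on the functional `p`. -/
def HasCoaction {ι : Type*} (p : Module.Dual k H) (s : Finset ι) (q : ι → Module.Dual k H)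
    (y : ι → H) : Prop :=
  ∀ w, evalSnd p (comul w) = ∑ i ∈ s, q i w • y i

lemma exists_hasCoaction {p : Module.Dual k H} (hp : p ∈ rationalDual k H) :
    ∃ s : Finset (Module.Dual k H × H), HasCoaction p s Prod.fst Prod.snd := by
  obtain ⟨t, ht⟩ := hp
  obtain ⟨s, rfl⟩ := TensorProduct.exists_finset t
  refine ⟨s, fun w => dual_ext (k := k) fun f => ?_⟩
  rw [← conv_apply_eq_evalSnd, ht f]
  simp [dualAct, mul_comm]

variable {ι : Type*} {p : Module.Dual k H} {s : Finset ι} {q : ι → Module.Dual k H} {y : ι → H}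

/-- Coassociativity of the coaction on rational functionals, inherited from that of Δ. -/
lemma HasCoaction.sum_tmul (hp : HasCoaction p s q y) (w : H) :
    ∑ i ∈ s, evalSnd (q i) (comul w) ⊗ₜ[k] y i = ∑ i ∈ s, q i w • comul (y i) := by
  have h1 (u : H ⊗[k] H) : comul (R := k) (evalSnd p u) = evalSnd p (comul.rTensor H u) := by
    induction u with
    | zero => simp
    | tmul a b => simp
    | add a b ha hb => simp [ha, hb]
  have h2 (v : H ⊗[k] (H ⊗[k] H)) :
      evalSnd p ((TensorProduct.assoc k H H H).symm v) = (evalSnd p).lTensor H v := by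
    induction v with
    | zero => simp
    | add a b ha hb => simp [ha, hb]
    | tmul a v =>
      induction v with
      | zero => simp
      | tmul b c => simp
      | add b c hb hc => simp [tmul_add, hb, hc]
  have h3 := h1 (comul w)
  rw [← coassoc_symm_apply, h2, hp w] at h3
  simp only [map_sum, map_smul] at h3
  rw [h3, ← (ℛ k w).eq]
  simp only [map_sum, LinearMap.lTensor_tmul, evalSnd_tmul, hp _, TensorProduct.sum_tmul,
    TensorProduct.tmul_sum, TensorProduct.tmul_smul, TensorProduct.smul_tmul']
  exact Finset.sum_comm

lemma HasCoaction.dual_act (hp : HasCoaction p s q y) (f : Module.Dual k H) :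
    HasCoaction (∑ i ∈ s, f (y i) • q i) s q (fun i => evalSnd f (comul (y i))) := by
  intro w
  have h := congrArg (evalSnd f) (hp.sum_tmul w)
  simp only [map_sum, evalSnd_tmul, map_smul] at h
  rw [← h]
  have (u : H ⊗[k] H) : evalSnd (∑ i ∈ s, f (y i) • q i) u = ∑ i ∈ s, f (y i) • evalSnd (q i) u := by
    induction u with
    | zero => simp
    | tmul a b => simp [Finset.sum_smul, smul_smul]
    | add a b ha hb => simp [ha, hb, Finset.sum_add_distrib]
  exact this _

lemma HasCoaction.comp_mulLeft (hp : HasCoaction p s q y) {κ : Type*} {c : H} (r : Repr k c κ) :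
    HasCoaction (p ∘ₗ LinearMap.mulLeft k c) (r.index ×ˢ s)
      (fun j => q j.2 ∘ₗ LinearMap.mulLeft k (r.right j.1))
      (fun j => S (r.left j.1) * y j.2) := by
  intro w
  have (u : H ⊗[k] H) : evalSnd (p ∘ₗ LinearMap.mulLeft k c) u =
      evalSnd p (((1 : H) ⊗ₜ[k] c) * u) := by
    induction u with
    | zero => simp
    | tmul a b => simp
    | add a b ha hb => rw [map_add, ha, hb, mul_add, map_add]
  rw [this, ← sum_antipode_tmul_mul_comul r]
  simp only [Finset.sum_mul, mul_assoc, map_sum, evalSnd_tmul_one_mul, ← Bialgebra.comul_mul,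
    hp _, Finset.mul_sum, Finset.sum_product]
  simp

/-- The left integral obtained from a rational functional by projecting to the coinvariants of the
Hopf module `H*ʳᵃᵗ`. -/
lemma HasCoaction.isLeftIntegral (hp : HasCoaction p s q y) :
    IsLeftIntegral (∑ i ∈ s, q i ∘ₗ LinearMap.mulRight k (S (S (y i)))) := by
  rw [isLeftIntegral_iff]
  intro x
  have e (u : H ⊗[k] H) : evalSnd (∑ i ∈ s, q i ∘ₗ LinearMap.mulRight k (S (S (y i)))) u =
      ∑ i ∈ s, evalSnd (q i) (u * ((1 : H) ⊗ₜ[k] S (S (y i)))) := by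
    induction u with
    | zero => simp
    | tmul a b => simp [Finset.sum_smul]
    | add a b ha hb => simp [ha, hb, add_mul, Finset.sum_add_distrib]
  -- T(y) = x S²(y₂) ⊗ S(y₁). Substituting it in coassociativity and multiplying cancels y₁S(y₂) on
  -- the right-hand side.
  let T : H →ₗ[k] H ⊗[k] H :=
    TensorProduct.map (LinearMap.mulLeft k x ∘ₗ S ∘ₗ S) S ∘ₗ
      (TensorProduct.comm k H H).toLinearMap ∘ₗ comul
  have key : ∑ i ∈ s, (evalSnd (q i) ∘ₗ comul) ⊗ₜ[k] y i =
      ∑ i ∈ s, (LinearMap.smulRightₗ (q i)).rTensor H (comul (y i)) := by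
    apply hom_tensor_ext
    intro w
    have h1 (i : ι) (u : H ⊗[k] H) : (LinearMap.applyₗ (R := k) w).rTensor H
        ((LinearMap.smulRightₗ (M := H) (q i)).rTensor H u) = q i w • u := by
      induction u with
      | zero => simp
      | tmul a b => simp [TensorProduct.smul_tmul']
      | add a b ha hb => simp [ha, hb]
    simpa [h1] using hp.sum_tmul w
  have key' := congrArg (fun z => LinearMap.mul' k H (substHom T z)) key
  have lhs (i : ι) : evalSnd (q i) (comul x * ((1 : H) ⊗ₜ[k] S (S (y i)))) =
      LinearMap.mul' k H (substHom T ((evalSnd (q i) ∘ₗ comul) ⊗ₜ[k] y i)) := by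
    rw [← sum_comul_antipode_mul_tmul (reprAntipode (ℛ k (y i))), substHom_tmul,
      LinearMap.comp_apply, LinearMap.comp_apply, ← (ℛ k (y i)).eq]
    simp [Finset.mul_sum, ← mul_assoc]
  have rhs (i : ι) : LinearMap.mul' k H
      (substHom T ((LinearMap.smulRightₗ (q i)).rTensor H (comul (y i)))) =
      q i (x * S (S (y i))) • (1 : H) := by
    have h1 (a b : H) : LinearMap.mul' k H
        (substHom T ((LinearMap.smulRightₗ (q i)).rTensor H (a ⊗ₜ[k] b))) =
        evalSnd (q i ∘ₗ LinearMap.mulLeft k x ∘ₗ S ∘ₗ S)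
          ((a ⊗ₜ[k] (1 : H)) * (S).rTensor H (comul b)) := by
      rw [evalSnd_tmul_one_mul, LinearMap.rTensor_tmul, substHom_tmul, LinearMap.comp_apply,
        LinearMap.comp_apply]
      induction comul (R := k) b with
      | zero => simp
      | tmul c d => simp
      | add c d hc hd => simp only [map_add, hc, hd, mul_add]
    rw [← (ℛ k (y i)).eq]
    simp only [map_sum, h1]
    rw [← map_sum, sum_tmul_mul_antipode_comul]
    simp
  simp only [map_sum, ← lhs, rhs] at key'
  rw [e, key']
  simp [Finset.sum_smul]

/-- The integrals built from all the functionals f(yᵢ)qᵢ give ∑ qᵢ(S(v) S²(yᵢ₁)) yᵢ₂ = 0; putting v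
= yᵢ₂ leaves ∑ ε(yᵢ) qᵢ(1) = p(1). -/
lemma HasCoaction.apply_one_eq_zero (hp : HasCoaction p s q y)
    (H0 : ∀ l : Module.Dual k H, IsLeftIntegral l → l ∘ₗ S = 0) : p 1 = 0 := by
  let r (i : ι) := ℛ k (y i)
  let f (j : (_ : ι) × H × H) : Module.Dual k H :=
    q j.1 ∘ₗ LinearMap.mulRight k (S (S ((r j.1).left j.2))) ∘ₗ S
  have h1 (v : H) : ∑ j ∈ s.sigma fun i => (r i).index, f j v • (r j.1).right j.2 = 0 := by
    apply dual_ext (k := k)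
    intro g
    have h2 := LinearMap.congr_fun (H0 _ (hp.dual_act g).isLeftIntegral) v
    rw [LinearMap.zero_apply] at h2
    rw [Finset.sum_sigma, map_zero]
    refine Eq.trans ?_ h2
    simp only [LinearMap.comp_apply, LinearMap.sum_apply, map_sum, LinearMap.mulRight_apply]
    refine Finset.sum_congr rfl fun i _ => ?_
    rw [← (r i).eq]
    simp [f, Finset.mul_sum, mul_comm]
  have h2 := sum_evalFst_eq_of_forall (f := f) (y := fun j => (r j.1).right j.2)
    (s' := (∅ : Finset ℕ)) (g := 0) (z := 0) (by simpa using h1) ((TensorProduct.mk k H H).flip 1)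
  rw [Finset.sum_sigma] at h2
  have h3 (i : ι) : ∑ j ∈ (r i).index,
      evalFst (f ⟨i, j⟩) ((TensorProduct.mk k H H).flip 1 ((r i).right j)) =
      (counit (R := k) (y i) * q i 1) • (1 : H) := by
    have := congrArg (fun z => q i (S z)) (sum_antipode_mul_eq_smul (r i))
    simp only [map_sum, antipode_mul_antidistrib] at this
    simp [f, ← Finset.sum_smul, this]
  simp only [h3, ← Finset.sum_smul, Finset.sum_empty] at h2
  have h4 := congrArg (counit (R := k)) h2
  have h5 := congrArg (counit (R := k)) (hp 1)
  simp only [map_sum, map_smul, Bialgebra.comul_one, Algebra.TensorProduct.one_def, evalSnd_tmul,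
    Bialgebra.counit_one, smul_eq_mul, mul_one, map_zero] at h4 h5
  rw [h5, ← h4]
  exact Finset.sum_congr rfl fun i _ => mul_comm _ _

/-- A co-Frobenius Hopf algebra has a left integral which does not vanish on the image of the
antipode. -/
lemma IsCoFrobenius.exists_isLeftIntegral (hH : IsCoFrobenius k H) :
    ∃ l : Module.Dual k H, IsLeftIntegral l ∧ l ∘ₗ S ≠ 0 := by
  by_contra! H0
  apply hH
  rw [eq_bot_iff]
  intro p hp
  obtain ⟨s, hs⟩ := exists_hasCoaction hp
  rw [Submodule.mem_bot]
  ext c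
  -- p(c) is the value at 1 of the translate p(c ·), which also has a coaction.
  simpa using (hs.comp_mulLeft (ℛ k c)).apply_one_eq_zero H0

/-! ### Faithfulness and uniqueness of integrals -/

/-- The composition inverse of a bijective antipode. -/
def antipodeInv (hS : Function.Bijective (antipode k (A := H))) : H →ₗ[k] H :=
  (LinearEquiv.ofBijective S hS).symm.toLinearMap

@[simp] lemma antipode_antipodeInv (hS : Function.Bijective (antipode k (A := H)))
    (x : H) : S (antipodeInv hS x) = x :=
  (LinearEquiv.ofBijective S hS).apply_symm_apply x

@[simp] lemma antipodeInv_antipode (hS : Function.Bijective (antipode k (A := H)))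
    (x : H) : antipodeInv hS (S x) = x :=
  (LinearEquiv.ofBijective S hS).symm_apply_apply x

@[simp] lemma antipodeInv_one (hS : Function.Bijective (antipode k (A := H))) :
    antipodeInv hS (1 : H) = 1 :=
  hS.1 (by simp)

lemma antipodeInv_mul (hS : Function.Bijective (antipode k (A := H))) (x y : H) :
    antipodeInv hS (x * y) = antipodeInv hS y * antipodeInv hS x :=
  hS.1 (by simp [antipode_mul_antidistrib])

lemma IsLeftIntegral.smul_eq_smul {l l' : Module.Dual k H}
    (hS : Function.Bijective (antipode k (A := H))) (hl : IsLeftIntegral l)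
    (hl' : IsLeftIntegral l') {y y' : H} (h : ∀ m, l' (y' * m) = l (y * m)) (m : H) :
    l' m • y' = l m • y := by
  have h1 (m : H) : evalSnd l' (comul y' * ((1 : H) ⊗ₜ[k] m)) =
      evalSnd l (comul y * ((1 : H) ⊗ₜ[k] m)) := by
    apply hS.1
    rw [← hl.evalSnd_one_tmul_mul_comul, ← hl'.evalSnd_one_tmul_mul_comul, ← (ℛ k m).eq]
    simp [Finset.mul_sum, h]
  let r := ℛ k y
  let r' := ℛ k y'
  have h2 (m : H) : ∑ i ∈ r'.index, (l' ∘ₗ LinearMap.mulLeft k (r'.right i)) m • r'.left i =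
      ∑ i ∈ r.index, (l ∘ₗ LinearMap.mulLeft k (r.right i)) m • r.left i := by
    have := h1 m
    rw [← r.eq, ← r'.eq] at this
    simpa [Finset.sum_mul] using this
  -- Replace m by S⁻¹(y₂)m in y₁ l(y₂ m), the old y₂ becoming y₃; then y₃S⁻¹(y₂) cancels and l(m) y
  -- remains.
  have h3 := sum_evalFst_eq_of_forall h2 ((LinearMap.mulRight k m ∘ₗ antipodeInv hS).rTensor H ∘ₗ
    (TensorProduct.comm k H H).toLinearMap ∘ₗ comul)
  have h4 (f : Module.Dual k H) (c : H) (w : H ⊗[k] H) :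
      evalFst (f ∘ₗ LinearMap.mulLeft k c) ((LinearMap.mulRight k m ∘ₗ antipodeInv hS).rTensor H
        (TensorProduct.comm k H H w)) =
      evalSnd (f ∘ₗ LinearMap.mulRight k m ∘ₗ antipodeInv hS) (w * ((1 : H) ⊗ₜ[k] S c)) := by
    induction w with
    | zero => simp
    | tmul a b => simp [antipodeInv_mul, mul_assoc]
    | add a b ha hb => simp only [map_add, ha, hb, add_mul]
  simp only [LinearMap.comp_apply, LinearEquiv.coe_coe, h4] at h3
  simpa only [← map_sum, sum_comul_mul_tmul_antipode, evalSnd_tmul, LinearMap.comp_apply,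
    antipodeInv_one, LinearMap.mulRight_apply, one_mul] using h3

lemma IsLeftIntegral.eq_of_forall_mul {l : Module.Dual k H}
    (hS : Function.Bijective (antipode k (A := H))) (hl : IsLeftIntegral l) (h0 : l ≠ 0)
    {y y' : H} (h : ∀ m, l (y * m) = l (y' * m)) : y = y' := by
  obtain ⟨z, hz⟩ := exists_apply_eq_one h0
  simpa [hz] using hl.smul_eq_smul hS hl h z

lemma IsLeftIntegral.exists_eq_smul {l l' ρ : Module.Dual k H}
    (hS : Function.Bijective (antipode k (A := H))) (hl : IsLeftIntegral l)
    (h0 : l ≠ 0) (hρ : IsRightIntegral ρ) (h0' : ρ ≠ 0) (hl' : IsLeftIntegral l') :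
    ∃ c : k, l' = c • l := by
  obtain ⟨x, hx⟩ := hl'.exists_right hρ h0' 1
  obtain ⟨y, hy⟩ := hl.exists_left hρ h0 x
  obtain ⟨z, hz⟩ := exists_apply_eq_one h0
  have key := hl.smul_eq_smul hS hl' fun m => (hx m).symm.trans (hy m)
  have hy : l' z • 1 = y := by simpa [hz] using key z
  refine ⟨l' z, LinearMap.ext fun h => ?_⟩
  have := congrArg (counit (R := k)) (key h)
  rw [← hy] at this
  simpa [mul_comm] using this

/-- A nonzero left integral of a Hopf algebra with bijective antipode, whose left integrals are
unique up to scalars. -/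
structure IsBasicIntegral (l : Module.Dual k H) : Prop where
  isLeftIntegral : IsLeftIntegral l
  ne_zero : l ≠ 0
  exists_eq_smul : ∀ l', IsLeftIntegral l' → ∃ c : k, l' = c • l
  bijective : Function.Bijective S

lemma IsCoFrobenius.exists_isBasicIntegral (hH : IsCoFrobenius k H) :
    ∃ l : Module.Dual k H, IsBasicIntegral l := by
  obtain ⟨l, hl, h1⟩ := hH.exists_isLeftIntegral
  have h0 : l ≠ 0 := by
    rintro rfl
    exact h1 (LinearMap.zero_comp _)
  have hρ := hl.isRightIntegral_comp_antipode h0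
  have hS : Function.Bijective S :=
    ⟨hl.antipode_injective h0, hl.antipode_surjective hρ h0 h1⟩
  exact ⟨l, hl, h0, fun l' hl' => hl.exists_eq_smul hS h0 hρ h1 hl', hS⟩

/-! ### The modular element and the Frobenius automorphism -/

namespace IsBasicIntegral

variable {l : Module.Dual k H}

lemma exists_groupLike (hl : IsBasicIntegral l) :
    ∃ b : GroupLike k H, ∀ h, evalFst l (comul h) = l h • b.val := by
  obtain ⟨z, hz⟩ := exists_apply_eq_one hl.ne_zero
  -- This functional is l * f, and left integrals are stable under right convolution; uniqueness
  -- then makes it a multiple of l.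
  have h1 (f : Module.Dual k H) : IsLeftIntegral (f ∘ₗ evalFst l ∘ₗ comul) := by
    intro g
    have : toConv (f ∘ₗ evalFst l ∘ₗ comul) = toConv l * toConv f := by
      ext h
      rw [conv_apply_eq_evalSnd, apply_evalSnd]
      rfl
    rw [this, ← mul_assoc, hl.isLeftIntegral g, smul_mul_assoc]
  let b := evalFst l (comul (R := k) z)
  have h2 (h : H) : evalFst l (comul h) = l h • b := by
    apply dual_ext (k := k)
    intro f
    obtain ⟨c, hc⟩ := hl.exists_eq_smul _ (h1 f)
    have e (x : H) : f (evalFst l (comul x)) = c * l x := by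
      simpa using LinearMap.congr_fun hc x
    simp [b, e, hz, mul_comm]
  refine ⟨⟨b, ⟨?_, ?_⟩⟩, h2⟩
  · have (w : H ⊗[k] H) : counit (R := k) (evalFst l w) = l (evalSnd counit w) :=
      (apply_evalSnd counit l w).symm
    rw [this, evalSnd, LinearMap.comp_apply, lTensor_counit_comul]
    simpa using hz
  · have e1 (w : H ⊗[k] H) : comul (R := k) (evalFst l w) = evalFst l (comul.lTensor H w) := by
      induction w with
      | zero => simp
      | tmul a b => simp
      | add a b ha hb => simp [ha, hb]
    have e2 (w : (H ⊗[k] H) ⊗[k] H) : evalFst l (TensorProduct.assoc k H H H w) =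
        (evalFst l).rTensor H w := by
      induction w with
      | zero => simp
      | add a b ha hb => simp [ha, hb]
      | tmul v c =>
        induction v with
        | zero => simp
        | tmul a b => simp [TensorProduct.smul_tmul']
        | add a b ha hb => simp [add_tmul, ha, hb]
    have e3 (w : H ⊗[k] H) : (evalFst l).rTensor H (comul.rTensor H w) =
        b ⊗ₜ[k] evalFst l w := by
      induction w with
      | zero => simp
      | tmul x y => simp [h2, TensorProduct.smul_tmul]
      | add x y hx hy => simp [hx, hy, tmul_add]
    rw [e1, ← coassoc_apply, e2, e3]

lemma isModularElement_iff (hl : IsBasicIntegral l) {a : GroupLike k H} :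
    IsModularElement a ↔ ∀ h, evalFst l (comul h) = l h • (a⁻¹).val := by
  refine ⟨fun h x => h l hl.isLeftIntegral x, fun h l' hl' x => ?_⟩
  obtain ⟨c, rfl⟩ := hl.exists_eq_smul l' hl'
  have := congrArg (c • ·) (h x)
  simpa [LinearMap.rTensor_smul, evalFst, smul_smul] using this

lemma existsUnique_isModularElement (hl : IsBasicIntegral l) :
    ∃! a : GroupLike k H, IsModularElement a := by
  obtain ⟨b, hb⟩ := hl.exists_groupLike
  obtain ⟨z, hz⟩ := exists_apply_eq_one hl.ne_zero
  refine ⟨b⁻¹, hl.isModularElement_iff.2 (by simpa using hb), fun a ha => ?_⟩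
  replace ha := hl.isModularElement_iff.1 ha
  have := (ha z).symm.trans (hb z)
  rw [hz, one_smul, one_smul, GroupLike.val_inj] at this
  rw [← this, inv_inv]

lemma eq_of_forall_mul (hl : IsBasicIntegral l) {y y' : H}
    (h : ∀ m, l (y * m) = l (y' * m)) : y = y' :=
  hl.isLeftIntegral.eq_of_forall_mul hl.bijective hl.ne_zero h

lemma isFrobeniusAut_iff (hl : IsBasicIntegral l) {χ : H ≃ₐ[k] H} :
    IsFrobeniusAut χ ↔ ∀ h m, l (m * h) = l (χ h * m) := by
  refine ⟨fun h => h l hl.isLeftIntegral, fun h l' hl' x m => ?_⟩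
  obtain ⟨c, rfl⟩ := hl.exists_eq_smul l' hl'
  simp [h x m]

lemma isRightIntegral_comp_mulRight {b : GroupLike k H}
    (hb : ∀ h, evalFst l (comul h) = l h • b.val) :
    IsRightIntegral (l ∘ₗ LinearMap.mulRight k b.val) := by
  intro h
  have e (w : H ⊗[k] H) : evalFst (l ∘ₗ LinearMap.mulRight k b.val) w =
      evalFst l (w * (b.val ⊗ₜ[k] b.val)) * S b.val := by
    induction w with
    | zero => simp
    | tmul x y => simp [mul_assoc]
    | add x y hx hy => rw [map_add, hx, hy, add_mul, map_add, add_mul]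
  rw [e, ← b.isGroupLikeElem_val.comul_eq_tmul_self, ← Bialgebra.comul_mul, hb]
  simp

lemma existsUnique_isFrobeniusAut (hl : IsBasicIntegral l) :
    ∃! χ : H ≃ₐ[k] H, IsFrobeniusAut χ := by
  obtain ⟨b, hb⟩ := hl.exists_groupLike
  obtain ⟨z, hz⟩ := exists_apply_eq_one hl.ne_zero
  have hρ := isRightIntegral_comp_mulRight hb
  have h0 : l ∘ₗ LinearMap.mulRight k b.val ≠ 0 := fun h => by
    simpa [mul_assoc, hz] using LinearMap.congr_fun h (z * S b.val)
  have ex (h : H) : ∃ y, ∀ m, l (m * h) = l (y * m) := by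
    -- The factor S(b) = b⁻¹ undoes the translation by b in the right integral l(· b).
    simpa [mul_assoc] using hl.isLeftIntegral.exists_left hρ hl.ne_zero (h * S b.val)
  choose X hX using ex
  let χ : H →ₐ[k] H :=
    { toFun := X
      map_one' := hl.eq_of_forall_mul fun m => by rw [← hX]; simp
      map_zero' := hl.eq_of_forall_mul fun m => by rw [← hX]; simp
      map_mul' := fun x y => hl.eq_of_forall_mul fun m => by
        rw [← hX, mul_assoc, ← hX, mul_assoc, ← hX, mul_assoc]
      map_add' := fun x y => hl.eq_of_forall_mul fun m => by
        rw [← hX, mul_add, add_mul, map_add, map_add, ← hX, ← hX]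
      commutes' := fun c => hl.eq_of_forall_mul fun m => by
        rw [← hX, Algebra.commutes] }
  have hχ : Function.Bijective χ := by
    constructor
    · intro x y hxy
      have hxy : X x = X y := hxy
      rw [← sub_eq_zero]
      obtain ⟨w, hw⟩ := hl.bijective.2 (x - y)
      have : w = 0 := hl.isLeftIntegral.eq_zero_of_forall hl.ne_zero fun m => by
        rw [hw, mul_sub, map_sub, hX x, hX y, hxy, sub_self]
      rw [← hw, this, map_zero]
    · intro y
      obtain ⟨x, hx⟩ := hl.isLeftIntegral.exists_right hρ h0 y
      refine ⟨x * b.val, hl.eq_of_forall_mul fun m => ?_⟩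
      rw [← hx]
      exact (hX _ _).symm.trans (by simp [mul_assoc])
  refine ⟨AlgEquiv.ofBijective χ hχ, hl.isFrobeniusAut_iff.2 hX, fun χ' hχ' => ?_⟩
  replace hχ' := hl.isFrobeniusAut_iff.1 hχ'
  ext x
  exact hl.eq_of_forall_mul fun m => (hχ' x m).symm.trans (hX x m)

end IsBasicIntegral

/-! ### The Drinfeld element and its relation to the modular elements -/

section Drinfeld

/-- The linear map `x ⊗ y ↦ S(y) x`. -/
def antipodeMul : H ⊗[k] H →ₗ[k] H :=
  LinearMap.mul' k H ∘ₗ (S).rTensor H ∘ₗ (TensorProduct.comm k H H).toLinearMap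

@[simp] lemma antipodeMul_tmul (x y : H) : antipodeMul (x ⊗ₜ[k] y) = S y * x := by
  simp [antipodeMul]

lemma elemU_eq (R : (H ⊗[k] H)ˣ) : elemU R = antipodeMul (R : H ⊗[k] H) := rfl

lemma antipodeMul_mul_one_tmul (z : H ⊗[k] H) (c : H) :
    antipodeMul (z * ((1 : H) ⊗ₜ[k] c)) = S c * antipodeMul z := by
  induction z with
  | zero => simp
  | tmul x y => simp [antipode_mul_antidistrib, mul_assoc]
  | add x y hx hy => simp [add_mul, mul_add, hx, hy]

lemma antipodeMul_mul_tmul_one (z : H ⊗[k] H) (c : H) :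
    antipodeMul (z * (c ⊗ₜ[k] (1 : H))) = antipodeMul z * c := by
  induction z with
  | zero => simp
  | tmul x y => simp [mul_assoc]
  | add x y hx hy => simp [add_mul, hx, hy]

lemma antipodeMul_comm_comul_mul (c : H) (z : H ⊗[k] H) :
    antipodeMul (TensorProduct.comm k H H (comul c) * z) = counit (R := k) c • antipodeMul z := by
  induction z with
  | zero => simp
  | add x y hx hy => simp [mul_add, hx, hy]
  | tmul x y =>
    have e (w : H ⊗[k] H) : antipodeMul (TensorProduct.comm k H H w * x ⊗ₜ[k] y) =
        S y * LinearMap.mul' k H ((S).rTensor H w) * x := by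
      induction w with
      | zero => simp
      | tmul a b => simp [antipode_mul_antidistrib, mul_assoc]
      | add a b ha hb => simp [add_mul, mul_add, ha, hb]
    rw [e, mul_antipode_rTensor_comul_apply, ← Algebra.commutes, Algebra.algebraMap_eq_smul_one]
    simp

namespace IsQuasitriangular

variable {R : (H ⊗[k] H)ˣ}

lemma mul_rTensor_antipode (hR : IsQuasitriangular R) :
    (R : H ⊗[k] H) * (S).rTensor H (R : H ⊗[k] H) = 1 := by
  let Φ : H ⊗[k] (H ⊗[k] H) →ₗ[k] H ⊗[k] H :=
    (LinearMap.mul' k H ∘ₗ (S).lTensor H).rTensor H ∘ₗ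
      (TensorProduct.assoc k H H H).symm.toLinearMap
  have h1 (z : H ⊗[k] H) : Φ (TensorProduct.assoc k H H H (comul.rTensor H z)) =
      (1 : H) ⊗ₜ[k] evalFst counit z := by
    induction z with
    | zero => simp
    | tmul x y =>
      simp [Φ, Algebra.algebraMap_eq_smul_one, TensorProduct.smul_tmul]
    | add x y hx hy => simp only [map_add, hx, hy, tmul_add]
  have h2 (z w : H ⊗[k] H) : Φ (leg13 z * leg23 w) = z * (S).rTensor H w := by
    induction z with
    | zero => simp
    | add x y hx hy => simp only [map_add, add_mul, hx, hy]
    | tmul a b =>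
      induction w with
      | zero => simp
      | add x y hx hy => simp only [map_add, mul_add, hx, hy]
      | tmul c d => simp [Φ, leg13, leg23]
  rw [← h2, ← hR.comul_left, h1]
  have := hR.counit_left
  rw [evalFst, LinearMap.comp_apply, LinearEquiv.coe_coe, this, Algebra.TensorProduct.one_def]

lemma rTensor_antipode_mul_map_antipode (hR : IsQuasitriangular R) :
    (S).rTensor H (R : H ⊗[k] H) * TensorProduct.map S S (R : H ⊗[k] H) = 1 := by
  let Ψ : H ⊗[k] (H ⊗[k] H) →ₗ[k] H ⊗[k] H :=
    TensorProduct.map S (LinearMap.mul' k H ∘ₗ (S).lTensor H)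
  have h1 (z : H ⊗[k] H) : Ψ (comul.lTensor H z) = S (evalSnd counit z) ⊗ₜ[k] (1 : H) := by
    induction z with
    | zero => simp
    | tmul x y =>
      simp [Ψ, Algebra.algebraMap_eq_smul_one, TensorProduct.smul_tmul]
    | add x y hx hy => simp only [map_add, hx, hy, add_tmul]
  have h2 (z w : H ⊗[k] H) : Ψ (leg13 z * leg12 w) =
      (S).rTensor H w * TensorProduct.map S S z := by
    induction z with
    | zero => simp
    | add x y hx hy => simp only [map_add, mul_add, add_mul, hx, hy]
    | tmul a b =>
      induction w with
      | zero => simp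
      | add x y hx hy => simp only [map_add, mul_add, add_mul, hx, hy]
      | tmul c d => simp [Ψ, leg13, leg12, antipode_mul_antidistrib]
  rw [← h2, ← hR.comul_right, h1]
  have := hR.counit_right
  rw [evalSnd, LinearMap.comp_apply, LinearEquiv.coe_coe, this, Algebra.TensorProduct.one_def,
    antipode_one]

/-- Both sides are inverse to (S ⊗ id)R, one on each side. -/
lemma map_antipode (hR : IsQuasitriangular R) :
    TensorProduct.map S S (R : H ⊗[k] H) = R :=
  (left_inv_eq_right_inv hR.mul_rTensor_antipode hR.rTensor_antipode_mul_map_antipode).symm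

lemma mul_comul (hR : IsQuasitriangular R) (h : H) :
    (R : H ⊗[k] H) * comul h = TensorProduct.comm k H H (comul h) * (R : H ⊗[k] H) := by
  rw [hR.comul_cop, mul_assoc, Units.inv_mul, mul_one]

lemma antipode_antipode_mul_elemU (hR : IsQuasitriangular R) (h : H) :
    S (S h) * elemU R = elemU R * h := by
  rw [elemU_eq, ← antipodeMul_mul_tmul_one, ← sum_comul_mul_tmul_antipode (ℛ k h)]
  simp only [Finset.mul_sum, ← mul_assoc, hR.mul_comul, map_sum, antipodeMul_mul_one_tmul,
    antipodeMul_comm_comul_mul]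
  conv_lhs => rw [← sum_counit_smul (ℛ k h)]
  simp [Finset.sum_mul]

lemma exists_elemU_mul_eq_one (hR : IsQuasitriangular R) : ∃ w, elemU R * w = 1 := by
  let ω : H ⊗[k] H →ₗ[k] H := LinearMap.mul' k H ∘ₗ (S ∘ₗ S).lTensor H ∘ₗ
    (TensorProduct.comm k H H).toLinearMap
  -- The inverse of u is R²S²(R¹).
  refine ⟨ω R, ?_⟩
  have e (z : H ⊗[k] H) : elemU R * ω z =
      antipodeMul ((R : H ⊗[k] H) * (S).rTensor H (TensorProduct.map S S z)) := by
    induction z with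
    | zero => simp
    | add x y hx hy => simp only [map_add, mul_add, hx, hy]
    | tmul x y =>
      have : (S (S x)) ⊗ₜ[k] S y = ((1 : H) ⊗ₜ[k] S y) * (S (S x) ⊗ₜ[k] (1 : H)) := by simp
      rw [TensorProduct.map_tmul, LinearMap.rTensor_tmul, this, ← mul_assoc,
        antipodeMul_mul_tmul_one, antipodeMul_mul_one_tmul, ← elemU_eq,
        hR.antipode_antipode_mul_elemU]
      simp [ω, mul_assoc]
  rw [e, hR.map_antipode, hR.mul_rTensor_antipode, Algebra.TensorProduct.one_def]
  simp

lemma isUnit_elemU (hR : IsQuasitriangular R) : IsUnit (elemU R) := by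
  obtain ⟨w, hw⟩ := hR.exists_elemU_mul_eq_one
  refine isUnit_iff_exists_and_exists.2 ⟨⟨w, hw⟩, ⟨S (S w), ?_⟩⟩
  rw [hR.antipode_antipode_mul_elemU, hw]

lemma isUnit_antipode_elemU (hR : IsQuasitriangular R) : IsUnit (S (elemU R)) := by
  obtain ⟨w, hw⟩ := hR.isUnit_elemU.exists_right_inv
  obtain ⟨w', hw'⟩ := hR.isUnit_elemU.exists_left_inv
  refine isUnit_iff_exists_and_exists.2 ⟨⟨S w', ?_⟩, ⟨S w, ?_⟩⟩
  · rw [← antipode_mul_antidistrib, hw', antipode_one]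
  · rw [← antipode_mul_antidistrib, hw, antipode_one]

lemma evalFst_mul_tmul_one_mul (hR : IsQuasitriangular R) {l : Module.Dual k H}
    (hl : IsLeftIntegral l) (hS : Function.Bijective S) {b : GroupLike k H}
    (hb : ∀ h, evalFst l (comul h) = l h • b.val) (h : H) :
    evalFst l ((R : H ⊗[k] H) * (h ⊗ₜ[k] (1 : H))) * (elemU R * b.val) =
      S (elemU R) * evalFst l ((h ⊗ₜ[k] (1 : H)) * (R : H ⊗[k] H)) := by
  let A : H ⊗[k] H →ₗ[k] H := LinearMap.mul' k H ∘ₗ (antipodeInv hS).rTensor H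
  let B : H ⊗[k] H →ₗ[k] H := LinearMap.mul' k H ∘ₗ (TensorProduct.comm k H H).toLinearMap ∘ₗ
    (antipodeInv hS).rTensor H
  have hB : B R = elemU R := by
    have (z : H ⊗[k] H) : B (TensorProduct.map S S z) = antipodeMul z := by
      induction z with
      | zero => simp
      | tmul x y => simp [B]
      | add x y hx hy => simp only [map_add, hx, hy]
    rw [elemU_eq, ← this, hR.map_antipode]
  have hA : A R = S (elemU R) := by
    have (z : H ⊗[k] H) : A (TensorProduct.map S S (TensorProduct.map S S z)) =
        S (antipodeMul z) := by
      induction z with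
      | zero => simp
      | tmul x y => simp [A, antipode_mul_antidistrib]
      | add x y hx hy => simp only [map_add, hx, hy]
    rw [elemU_eq, ← this, hR.map_antipode, hR.map_antipode]
  -- Uses l(x h₁)h₂ = S⁻¹(l(x₁h)x₂) b, so that the formula for Δ(R¹) ⊗ R² applies.
  have l1 (z : H ⊗[k] H) : evalFst l (z * comul h) =
      B (evalFst (l ∘ₗ LinearMap.mulRight k h)
        (TensorProduct.assoc k H H H (comul.rTensor H z))) * b.val := by
    induction z with
    | zero => simp
    | add x y hx hy => simp only [map_add, add_mul, hx, hy]
    | tmul x y =>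
      have e1 : evalFst l ((x ⊗ₜ[k] (1 : H)) * comul h) =
          antipodeInv hS (evalFst l (comul x * (h ⊗ₜ[k] (1 : H)))) * b.val := by
        rw [evalFst_comul_mul_tmul_one hb, antipodeInv_mul, antipodeInv_antipode, mul_assoc]
        have : antipodeInv hS b.val = S b.val := by
          apply hS.1
          simp
        rw [this]
        simp
      have e2 (w : H ⊗[k] H) : B (evalFst (l ∘ₗ LinearMap.mulRight k h)
          (TensorProduct.assoc k H H H (w ⊗ₜ[k] y))) =
          y * antipodeInv hS (evalFst l (w * (h ⊗ₜ[k] (1 : H)))) := by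
        induction w with
        | zero => simp
        | tmul c d => simp [B]
        | add c d hc hd => simp only [map_add, add_tmul, add_mul, mul_add, hc, hd]
      have e3 : x ⊗ₜ[k] y = ((1 : H) ⊗ₜ[k] y) * (x ⊗ₜ[k] (1 : H)) := by simp
      rw [LinearMap.rTensor_tmul, e2, e3, mul_assoc, evalFst_one_tmul_mul, e1, mul_assoc]
  have l2 (z w : H ⊗[k] H) : B (evalFst (l ∘ₗ LinearMap.mulRight k h) (leg13 z * leg23 w)) =
      evalFst l (z * (h ⊗ₜ[k] (1 : H))) * B w := by
    induction z with
    | zero => simp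
    | add x y hx hy => simp only [map_add, add_mul, hx, hy]
    | tmul a c =>
      induction w with
      | zero => simp
      | add x y hx hy => simp only [map_add, mul_add, hx, hy]
      | tmul d e => simp [B, leg13, leg23, mul_assoc]
  -- Uses h₁ l(h₂x) = S⁻¹(x₁) l(h x₂).
  have r1 (z : H ⊗[k] H) : evalFst l (TensorProduct.comm k H H (comul h) * z) =
      A (evalFst (l ∘ₗ LinearMap.mulLeft k h) (TensorProduct.leftComm k H H H
        (TensorProduct.assoc k H H H (comul.rTensor H z)))) := by
    induction z with
    | zero => simp
    | add x y hx hy => simp only [map_add, mul_add, hx, hy]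
    | tmul x y =>
      have e1 (w : H ⊗[k] H) : evalFst l (TensorProduct.comm k H H w * (x ⊗ₜ[k] y)) =
          evalSnd l (w * ((1 : H) ⊗ₜ[k] x)) * y := by
        induction w with
        | zero => simp
        | tmul c d => simp
        | add c d hc hd => simp only [map_add, add_mul, hc, hd]
      have e2 (w : H ⊗[k] H) : A (evalFst (l ∘ₗ LinearMap.mulLeft k h)
          (TensorProduct.leftComm k H H H (TensorProduct.assoc k H H H (w ⊗ₜ[k] y)))) =
          antipodeInv hS (evalSnd l (((1 : H) ⊗ₜ[k] h) * w)) * y := by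
        induction w with
        | zero => simp
        | tmul c d => simp [A]
        | add c d hc hd => simp only [map_add, add_tmul, add_mul, mul_add, hc, hd]
      rw [e1, LinearMap.rTensor_tmul, e2, hl.evalSnd_one_tmul_mul_comul, antipodeInv_antipode]
  have r2 (z w : H ⊗[k] H) : A (evalFst (l ∘ₗ LinearMap.mulLeft k h)
      (TensorProduct.leftComm k H H H (leg13 z * leg23 w))) =
      A z * evalFst l ((h ⊗ₜ[k] (1 : H)) * w) := by
    induction z with
    | zero => simp
    | add x y hx hy => simp only [map_add, add_mul, hx, hy]
    | tmul a c =>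
      induction w with
      | zero => simp
      | add x y hx hy => simp only [map_add, mul_add, hx, hy]
      | tmul d e => simp [A, leg13, leg23, mul_assoc]
  have main := congrArg (evalFst l) (hR.mul_comul h)
  rwa [l1, r1, hR.comul_left, l2, r2, hA, hB, mul_assoc] at main

/-- The Drinfeld element `u`, the distinguished group-like elements and the antipode are related by
`u a⁻¹ = S(u) a_α`. -/
lemma elemU_mul_modularElement_inv (hR : IsQuasitriangular R) {l : Module.Dual k H}
    (hl : IsBasicIntegral l) {a : GroupLike k H} (ha : IsModularElement a) {χ : H ≃ₐ[k] H}
    (hχ : IsFrobeniusAut χ) :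
    elemU R * (a⁻¹).val = S (elemU R) * evalLeft (modularFunctional χ) R := by
  have hb := hl.isModularElement_iff.1 ha
  have hχ := hl.isFrobeniusAut_iff.1 hχ
  apply dual_ext (k := k)
  intro f
  have e1 (h : H) (z : H ⊗[k] H) : f (evalFst l (z * (h ⊗ₜ[k] (1 : H))) *
      (elemU R * (a⁻¹).val)) =
      l (evalSnd (f ∘ₗ LinearMap.mulRight k (elemU R * (a⁻¹).val)) z * h) := by
    induction z with
    | zero => simp
    | tmul x y => simp [mul_comm, mul_assoc]
    | add x y hx hy => rw [add_mul, map_add, add_mul, map_add, hx, hy, map_add, add_mul, map_add]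
  have e2 (h : H) (z : H ⊗[k] H) : f (S (elemU R) * evalFst l ((h ⊗ₜ[k] (1 : H)) * z)) =
      l (χ (evalSnd (f ∘ₗ LinearMap.mulLeft k (S (elemU R))) z) * h) := by
    induction z with
    | zero => simp
    | tmul x y =>
      rw [Algebra.TensorProduct.tmul_mul_tmul, evalFst_tmul, evalSnd_tmul, hχ]
      simp [mul_comm]
    | add x y hx hy => simp only [mul_add, map_add, add_mul, hx, hy]
  -- This is R¹ ⊗ R²ua⁻¹ = χ(R¹) ⊗ S(u)R² with f applied to the second factor.
  have key : evalSnd (f ∘ₗ LinearMap.mulRight k (elemU R * (a⁻¹).val)) (R : H ⊗[k] H) =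
      χ (evalSnd (f ∘ₗ LinearMap.mulLeft k (S (elemU R))) (R : H ⊗[k] H)) :=
    hl.eq_of_forall_mul fun h => by
      rw [← e1, ← e2, hR.evalFst_mul_tmul_one_mul hl.isLeftIntegral hl.bijective hb]
  have key' := congrArg (counit (R := k)) key
  have h1 : evalFst counit (R : H ⊗[k] H) = 1 := hR.counit_left
  rw [apply_evalSnd, h1] at key'
  have h2 (x : H) : counit (R := k) (χ x) = (modularFunctional χ).toLinearMap x := rfl
  rw [h2, apply_evalSnd] at key'
  simpa [evalLeft, evalFst] using key'

end IsQuasitriangular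

end Drinfeld

end Hopf

end

end CoFrobeniusHopf

theorem corollary2p5 {k : Type*} {H : Type*} [Field k] [Ring H] [HopfAlgebra k H]
    (hH : CoFrobeniusHopf.IsCoFrobenius k H)
    (R : (H ⊗[k] H)ˣ) (hR : CoFrobeniusHopf.IsQuasitriangular R) :
    (∃! a : GroupLike k H, CoFrobeniusHopf.IsModularElement a) ∧
    (∃! χ : H ≃ₐ[k] H, CoFrobeniusHopf.IsFrobeniusAut χ) ∧
    IsUnit (HopfAlgebra.antipode k (CoFrobeniusHopf.elemU R)) ∧
    ∀ (a : GroupLike k H) (χ : H ≃ₐ[k] H),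
      CoFrobeniusHopf.IsModularElement a → CoFrobeniusHopf.IsFrobeniusAut χ →
      (CoFrobeniusHopf.modularFunctional χ = Bialgebra.counitAlgHom k H →
        CoFrobeniusHopf.elemV R * CoFrobeniusHopf.elemU R = a.val ∧
        ∀ R' : (H ⊗[k] H)ˣ, CoFrobeniusHopf.IsQuasitriangular R' →
          CoFrobeniusHopf.elemV R' * CoFrobeniusHopf.elemU R' =
            CoFrobeniusHopf.elemV R * CoFrobeniusHopf.elemU R) ∧
      (HopfAlgebra.antipode k (CoFrobeniusHopf.elemU R) = CoFrobeniusHopf.elemU R ↔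
        CoFrobeniusHopf.evalLeft (CoFrobeniusHopf.modularFunctional χ) R = (a⁻¹).val) := by
  obtain ⟨l, hl⟩ := hH.exists_isBasicIntegral
  refine ⟨hl.existsUnique_isModularElement, hl.existsUnique_isFrobeniusAut,
    hR.isUnit_antipode_elemU, fun a χ ha hχ => ⟨fun hα => ?_, ?_⟩⟩
  -- Proved for every R at once: a and χ do not depend on R, so independence is immediate.
  · have key (R : (H ⊗[k] H)ˣ) (hR : CoFrobeniusHopf.IsQuasitriangular R) :
        CoFrobeniusHopf.elemV R * CoFrobeniusHopf.elemU R = a.val := by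
      have h1 := hR.elemU_mul_modularElement_inv hl ha hχ
      have h2 : CoFrobeniusHopf.evalLeft (Bialgebra.counitAlgHom k H) R = 1 := hR.counit_left
      rw [hα, h2, mul_one] at h1
      have h3 := congrArg (· * a.val) h1
      rw [mul_assoc, ← GroupLike.val_mul, inv_mul_cancel, GroupLike.val_one, mul_one] at h3
      rw [CoFrobeniusHopf.elemV]
      nth_rw 2 [h3]
      rw [← mul_assoc, Ring.inverse_mul_cancel _ hR.isUnit_antipode_elemU, one_mul]
    exact ⟨key R hR, fun R' hR' => (key R' hR').trans (key R hR).symm⟩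
  · have h1 := hR.elemU_mul_modularElement_inv hl ha hχ
    constructor
    · intro h
      rw [h] at h1
      exact (hR.isUnit_elemU.mul_left_cancel h1).symm
    · intro h
      rw [h] at h1
      exact ((a⁻¹).isGroupLikeElem_val.isUnit.mul_right_cancel h1).symm
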